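/- For $n\ge 1$ let $\mathfrak{S}_n$ be the set of permutations of $\{1,\dots,n\}$ and let $\mathfrak{D}_n\subseteq\mathfrak{S}_n$ be the set of derangements (permutations without fixed points). For a pattern $\tau\in\mathfrak{S}_3$, let $\mathfrak{S}_n(\tau)$ (resp. $\mathfrak{D}_n(\tau)$) be the set of those $\pi\in\mathfrak{S}_n$ (resp. $\pi\in\mathfrak{D}_n$) that avoid $\tau$, i.e. for which there are no indices $i_1<i_2<i_3$ such that $\pi(i_1)\pi(i_2)\pi(i_3)$ is order-isomorphic to $\tau$. Let $\mathsf{exc}\,\pi=\#\{i : \pi(i)>i\}$ be the number of excedances of $\pi$, and let $C_m=\frac{1}{m+1}\binom{2m}{m}$ be the $m$-th Catalan number. Then for any $n\ge 1$, $$\sum_{\pi\in\mathfrak{S}_n(213)}(-1)^{\mathsf{exc}\,\pi}=\sum_{\pi\in\mathfrak{S}_n(132)}(-1)^{\mathsf{exc}\,\pi}=\begin{cases}0 & \text{if $n$ is even},\\ (-1)^{\frac{n-1}{2}}C_{\frac{n-1}{2}} & \text{if $n$ is odd},\end{cases}$$ $$\sum_{\pi\in\mathfrak{D}_n(213)}(-1)^{\mathsf{exc}\,\pi}=\sum_{\pi\in\mathfrak{D}_n(132)}(-1)^{\mathsf{exc}\,\pi}=\begin{cases}(-1)^{\frac{n}{2}}C_{\frac{n}{2}}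 & \text{if $n$ is even},\\ 0 & \text{if $n$ is odd}.\end{cases}$$ -/

import Mathlib

namespace PermPattern

/-- `π` contains the pattern `p`: at some positions `f 0 < f 1 < ⋯ < f (k - 1)`
the entries of `π` are in the same relative order as `p 0, …, p (k - 1)`. -/
def Contains {n k : ℕ} (π : Equiv.Perm (Fin n)) (p : Equiv.Perm (Fin k)) : Prop :=
  ∃ f : Fin k → Fin n, (∀ i j, i < j → f i < f j) ∧ ∀ i j, π (f i) < π (f j) ↔ p i < p j

instance {n k : ℕ} (π : Equiv.Perm (Fin n)) (p : Equiv.Perm (Fin k)) :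
    Decidable (Contains π p) := by
  unfold Contains; infer_instance

/-- The permutations of length `n` that avoid the pattern `p`. -/
def avoiding (n : ℕ) {k : ℕ} (p : Equiv.Perm (Fin k)) : Finset (Equiv.Perm (Fin n)) :=
  Finset.univ.filter fun π => ¬ Contains π p

/-- The derangements of length `n` that avoid the pattern `p`. -/
def derangementsAvoiding (n : ℕ) {k : ℕ} (p : Equiv.Perm (Fin k)) :
    Finset (Equiv.Perm (Fin n)) :=
  (avoiding n p).filter fun π => π ∈ derangements (Fin n)

/-- The number of excedances, that is, of positions `i` with `π i > i`. -/
def exc {n : ℕ} (π : Equiv.Perm (Fin n)) : ℕ :=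
  (Finset.univ.filter fun i => i < π i).card

/-- The pattern with one-line notation `213` (entries and positions are shifted by one,
so that they start at zero). -/
def pattern213 : Equiv.Perm (Fin 3) := Equiv.swap 0 1

/-- The pattern with one-line notation `132`. -/
def pattern132 : Equiv.Perm (Fin 3) := Equiv.swap 1 2

theorem pattern213_apply : (⇑pattern213 : Fin 3 → Fin 3) = ![1, 0, 2] := by decide

theorem pattern132_apply : (⇑pattern132 : Fin 3 → Fin 3) = ![0, 2, 1] := by decide

end PermPattern

/-! The bijection `revInv` exchanges 213 with 132 and preserves excedances and derangements, so only
132 matters. A 132-avoiding permutation is a balanced word of n pushes and n pops: positions are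
pushed from right to left, and each pop gives the next larger value to the top position. If j is
pushed at time u and receives v at time d, then u + d = 2(v - j) + 2n - 1. Hence excedances are the
arcs with midpoint to the right of the centre of the word, and fixed points the arcs centred there
(`sum_weight_eq_dequeSum`).

Such words are read from both ends at once (`dequeSum_symmetric`). Pairs of letters that keep the
height cancel, except at height 0, where they may form a centred arc of weight x. What remains is
`signedPaths`, with x = 1 for all permutations and x = 0 for derangements. The case x = 0 gives
ballot numbers (`signedPaths_zero_closed`), and x = 1 reduces to it (`signedPaths_one_succ`). -/

namespace PermPattern

/-! ### Words of pushes and pops, read from either end -/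

section Deque

variable {R : Type*} [CommRing R]

/-- Weighted sum over the words of pushes and pops read at the times `i, …, i + m - 1`, the store
`K` being a list with push and pop at its front, that empty the store. A pop at time `d` of an
entry pushed at time `u` has weight `χ (u + d)`. -/
def dequeSum (χ : ℤ → R) : ℕ → ℤ → List ℤ → R
  | 0, _, [] => 1
  | 0, _, _ :: _ => 0
  | m + 1, i, [] => dequeSum χ m (i + 1) [i]
  | m + 1, i, t :: K => dequeSum χ m (i + 1) (i :: t :: K) + χ (t + i) * dequeSum χ m (i + 1) K

theorem dequeSum_succ_nil (χ : ℤ → R) (m : ℕ) (i : ℤ) :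
    dequeSum χ (m + 1) i [] = dequeSum χ m (i + 1) [i] := rfl

theorem dequeSum_succ_cons (χ : ℤ → R) (m : ℕ) (i t : ℤ) (K : List ℤ) :
    dequeSum χ (m + 1) i (t :: K) =
      dequeSum χ m (i + 1) (i :: t :: K) + χ (t + i) * dequeSum χ m (i + 1) K := rfl

theorem dequeSum_eq_zero_of_lt (χ : ℤ → R) :
    ∀ (m : ℕ) (i : ℤ) (K : List ℤ), m < K.length → dequeSum χ m i K = 0
  | 0, _, [], h => by simp at h
  | 0, _, _ :: _, _ => rfl
  | m + 1, i, [], h => by simp at h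
  | m + 1, i, t :: K, h => by
    simp only [List.length_cons] at h
    rw [dequeSum, dequeSum_eq_zero_of_lt χ m _ _ (by simp; omega),
      dequeSum_eq_zero_of_lt χ m _ K (by omega)]
    simp

/-- The same sum computed by reading the last letter first. -/
theorem dequeSum_succ_right (χ : ℤ → R) (m : ℕ) :
    ∀ i : ℤ, dequeSum χ (m + 1) i [] = dequeSum χ m i [i + m] ∧
      ∀ (K : List ℤ) (t : ℤ), dequeSum χ (m + 1) i (K ++ [t]) =
        dequeSum χ m i (K ++ [t] ++ [i + m]) + χ (t + (i + m)) * dequeSum χ m i K := by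
  -- The last letter pops the bottom entry: either the old bottom `t`, or an entry pushed onto the
  -- empty store. Since `χ` sees only the sum of the two times, in the second case the last letter
  -- may instead lie in the store beneath `t` from the start. The induction says that reading on the
  -- left and on the right commute.
  induction m with
  | zero =>
    intro i
    refine ⟨by simp [dequeSum], fun K t => ?_⟩
    rcases K with _ | ⟨a, K⟩
    · simp [dequeSum]
    · cases K <;> simp [dequeSum]
  | succ m ih =>
    intro i
    have e : i + 1 + (m : ℤ) = i + ((m + 1 : ℕ) : ℤ) := by push_cast; ring
    obtain ⟨h₀, h₁⟩ := ih (i + 1)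
    rw [e] at h₀ h₁
    constructor
    · have h₂ := h₁ [] i
      simp only [List.nil_append, List.cons_append] at h₂
      rw [dequeSum_succ_nil, h₂, dequeSum_succ_cons χ m, add_comm (i + ((m + 1 : ℕ) : ℤ)) i]
    · intro K t
      cases K with
      | nil =>
        have h₂ := h₁ [i] t
        simp only [List.cons_append, List.nil_append] at h₂ ⊢
        rw [dequeSum_succ_cons χ (m + 1), h₂, h₀, dequeSum_succ_cons χ m, dequeSum_succ_nil χ m]
        ring
      | cons a K =>
        have h₂ := h₁ (i :: a :: K) t
        simp only [List.cons_append] at h₂ ⊢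
        rw [dequeSum_succ_cons χ (m + 1), h₂, h₁ K t, dequeSum_succ_cons χ m,
          dequeSum_succ_cons χ m]
        ring

end Deque

/-! ### Folding the word about its centre -/

/-- The weight of a value in terms of its displacement: `-1` if positive, `x` if zero. -/
def signWeight (x : ℤ) (d : ℤ) : ℤ := if d < 0 then 1 else if d = 0 then x else -1

/-- Signed count of the lattice paths with `j` double steps from height `h` to `0`; a flat
double step at height `0` has weight `x`. -/
def signedPaths (x : ℤ) : ℕ → ℕ → ℤ
  | 0, h => if h = 0 then 1 else 0
  | j + 1, 0 => x * signedPaths x j 0 - signedPaths x j 2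
  | j + 1, 1 => -signedPaths x j 3
  | j + 1, h + 2 => signedPaths x j h - signedPaths x j (h + 4)

/-- The weight that an entry of the store acquires on reading an interval starting at `i`. -/
def charge (i t : ℤ) : ℤ := if t < i then 1 else -1

/-- A stored time left of the interval has its arc midpoint left of the centre whichever letter of
the interval it meets, and one to the right has it right of the centre. So its weight `charge` is
known in advance and only the height of the store matters. -/
theorem dequeSum_symmetric (x : ℤ) (j : ℕ) : ∀ (i : ℤ) (K : List ℤ),
    (∀ t ∈ K, t < i ∨ i + 2 * j ≤ t) →
    dequeSum (fun y => signWeight x (y - (2 * i + 2 * j - 1))) (2 * j) i K =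
      (K.map (charge i)).prod * signedPaths x j K.length := by
  induction j with
  | zero => intro i K _; cases K <;> simp [dequeSum, signedPaths]
  | succ j ih =>
    intro i K hK
    set χ : ℤ → ℤ := fun y => signWeight x (y - (2 * i + 2 * ((j + 1 : ℕ) : ℤ) - 1)) with hχ
    -- Removing one letter at each end keeps the centre, so `χ` is unchanged.
    have ih' : ∀ K : List ℤ, (∀ t ∈ K, t < i + 1 ∨ i + 1 + 2 * j ≤ t) →
        dequeSum χ (2 * j) (i + 1) K =
        (K.map (charge (i + 1))).prod * signedPaths x j K.length := by
      intro K hK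
      rw [← ih (i + 1) K hK, hχ]
      congr 1
      funext y
      congr 1
      push_cast
      ring
    set l : ℤ := i + 1 + ((2 * j : ℕ) : ℤ) with hl
    have hR₀ : dequeSum χ (2 * j + 1) (i + 1) [] = dequeSum χ (2 * j) (i + 1) [l] :=
      (dequeSum_succ_right χ (2 * j) (i + 1)).1
    have hR : ∀ (K : List ℤ) (t : ℤ), dequeSum χ (2 * j + 1) (i + 1) (K ++ [t]) =
        dequeSum χ (2 * j) (i + 1) (K ++ [t] ++ [l]) +
          χ (t + l) * dequeSum χ (2 * j) (i + 1) K :=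
      (dequeSum_succ_right χ (2 * j) (i + 1)).2
    have hl' : l = i + 1 + 2 * j := by rw [hl]; push_cast; ring
    have c_i : charge (i + 1) i = 1 := by simp [charge]
    have c_l : charge (i + 1) l = -1 := by rw [charge, if_neg]; omega
    have χ_i : ∀ t, (t < i ∨ i + 2 * ((j + 1 : ℕ) : ℤ) ≤ t) → χ (t + i) = charge i t := by
      intro t ht
      simp only [hχ, signWeight, charge]
      push_cast at ht ⊢
      split_ifs <;> omega
    have χ_l : ∀ t, (t < i ∨ i + 2 * ((j + 1 : ℕ) : ℤ) ≤ t) → χ (t + l) = charge i t := by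
      intro t ht
      simp only [hχ, signWeight, charge]
      push_cast at ht ⊢
      split_ifs <;> omega
    have χ_il : χ (i + l) = x := by
      simp only [hχ, signWeight]
      push_cast
      split_ifs <;> first | rfl | omega
    have c_t : ∀ t, (t < i ∨ i + 2 * ((j + 1 : ℕ) : ℤ) ≤ t) → charge (i + 1) t = charge i t := by
      intro t ht
      simp only [charge]
      push_cast at ht ⊢
      split_ifs <;> omega
    have c_K : ∀ K : List ℤ, (∀ t ∈ K, t < i ∨ i + 2 * ((j + 1 : ℕ) : ℤ) ≤ t) →
        (K.map (charge (i + 1))).prod = (K.map (charge i)).prod := fun K h =>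
      congrArg List.prod (List.map_congr_left fun t ht => c_t t (h t ht))
    have in_K : ∀ K : List ℤ, (∀ t ∈ K, t < i ∨ i + 2 * ((j + 1 : ℕ) : ℤ) ≤ t) →
        ∀ t ∈ K, t < i + 1 ∨ i + 1 + 2 * j ≤ t := fun K h t ht => by
      have := h t ht
      push_cast at this
      omega
    have in_i : i < i + 1 ∨ i + 1 + 2 * j ≤ i := by omega
    have in_l : l < i + 1 ∨ i + 1 + 2 * j ≤ l := by omega
    have e2 : 2 * (j + 1) = 2 * j + 1 + 1 := by ring
    rw [e2]
    match K, hK with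
    | [], _ =>
      have h := hR [] i
      simp only [List.nil_append, List.singleton_append] at h
      rw [dequeSum, h, χ_il, ih' [] (by simp), ih' [i, l] (by grind)]
      simp [signedPaths, c_i, c_l]
      ring
    | [t], hK =>
      have h := hR [i] t
      have ht := hK t (by simp)
      have ht' := in_K _ hK t (by simp)
      simp only [List.cons_append, List.nil_append] at h
      rw [dequeSum, h, hR₀, χ_i t ht, χ_l t ht, ih' [i] (by grind), ih' [l] (by grind),
        ih' [i, t, l] (by grind)]
      simp [signedPaths, c_i, c_l, c_t t ht]
    | t :: s :: K, hK =>
      obtain ⟨K', u, hu⟩ : ∃ K' u, s :: K = K' ++ [u] :=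
        ⟨_, _, (List.dropLast_append_getLast (List.cons_ne_nil s K)).symm⟩
      rw [hu] at hK ⊢
      have hK' : ∀ t ∈ K', t < i ∨ i + 2 * ((j + 1 : ℕ) : ℤ) ≤ t := fun a ha => hK a (by simp [ha])
      have ht := hK t (by simp)
      have ht' := in_K _ hK t (by simp)
      have hu := hK u (by simp)
      have hu' := in_K _ hK u (by simp)
      have hin := in_K _ hK'
      have h := hR (i :: t :: K') u
      simp only [List.cons_append] at h
      -- The terms "push `i`, let `l` pop the bottom" and "pop the top, put `l` at the bottom" have
      -- equal height and opposite charge (`c_i`, `c_l`), so they cancel.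
      rw [dequeSum, h, hR, χ_i t ht, χ_l u hu, ih' (i :: t :: K'), ih' K' hin, ih' (K' ++ [u] ++ [l]),
        ih' (i :: t :: (K' ++ [u] ++ [l]))]
      · simp [signedPaths, c_i, c_l, c_t t ht, c_t u hu, c_K K' hK']
        ring
      all_goals
        intro a ha
        simp only [List.mem_cons, List.mem_append, List.not_mem_nil, or_false] at ha
        rcases ha with h | h
        all_goals grind

/-! ### Ballot numbers and evaluation of the signed paths -/

/-- The ballot numbers: lattice paths with `k` down and `t + k` up steps staying nonnegative. -/
def ballot (t : ℕ) : ℕ → ℤ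
  | 0 => 1
  | k + 1 => ((t + 2 * k + 2).choose (k + 1) : ℤ) - ((t + 2 * k + 2).choose k : ℤ)

theorem ballot_succ_succ (t k : ℕ) :
    ballot (t + 1) (k + 1) = ballot t (k + 1) + ballot (t + 2) k := by
  cases k with
  | zero => simp [ballot]; ring
  | succ k =>
    simp only [ballot]
    rw [show t + 1 + 2 * (k + 1) + 2 = (t + 2 * (k + 1) + 2) + 1 by ring,
      show t + 2 + 2 * k + 2 = t + 2 * (k + 1) + 2 by ring,
      Nat.choose_succ_succ' (t + 2 * (k + 1) + 2) (k + 1),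
      Nat.choose_succ_succ' (t + 2 * (k + 1) + 2) k]
    push_cast
    ring

theorem ballot_zero_succ (k : ℕ) : ballot 0 (k + 1) = ballot 1 k := by
  cases k with
  | zero => simp [ballot]
  | succ k =>
    simp only [ballot]
    have h : (2 * k + 3).choose (k + 2) = (2 * k + 3).choose (k + 1) :=
      Nat.choose_symm_of_eq_add (by ring)
    rw [show 0 + 2 * (k + 1) + 2 = (2 * k + 3) + 1 by ring,
      show 1 + 2 * k + 2 = 2 * k + 3 by ring, Nat.choose_succ_succ' (2 * k + 3) (k + 1),
      Nat.choose_succ_succ' (2 * k + 3) k, h]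
    push_cast
    ring

theorem ballot_zero_eq_catalan (k : ℕ) : ballot 0 k = catalan k := by
  cases k with
  | zero => simp [ballot]
  | succ k =>
    simp only [ballot]
    have h1 := succ_mul_catalan_eq_centralBinom (k + 1)
    rw [Nat.centralBinom] at h1
    have h2 := Nat.choose_succ_right_eq (2 * k + 2) k
    rw [show 2 * k + 2 - k = k + 2 by omega] at h2
    rw [show 2 * (k + 1) = 2 * k + 2 by ring] at h1
    rw [zero_add]
    zify at h1 h2
    have : ((k : ℤ) + 2) ≠ 0 := by positivity
    apply mul_left_cancel₀ this
    linear_combination -h1 + h2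

/-- With heights halved, a path from t to 0 with t + 2k steps has exactly k up steps, each of sign
-1; wrong parity or too few steps leaves no path. -/
theorem signedPaths_zero_closed (j : ℕ) : ∀ t : ℕ,
    (j < t → signedPaths 0 j (2 * t) = 0) ∧
    ∀ k, (j = t + 2 * k → signedPaths 0 j (2 * t) = (-1) ^ k * ballot t k) ∧
      (j = t + 2 * k + 1 → signedPaths 0 j (2 * t) = 0) := by
  induction j with
  | zero =>
    intro t
    refine ⟨fun h => by simp [signedPaths]; omega, fun k => ⟨fun h => ?_, fun h => by omega⟩⟩
    obtain rfl : t = 0 := by omega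
    obtain rfl : k = 0 := by omega
    simp [signedPaths, ballot]
  | succ j ih =>
    intro t
    cases t with
    | zero =>
      have e : signedPaths 0 (j + 1) (2 * 0) = -signedPaths 0 j (2 * 1) := by simp [signedPaths]
      refine ⟨fun h => by omega, fun k => ⟨fun h => ?_, fun h => ?_⟩⟩
      · cases k with
        | zero => omega
        | succ k =>
          rw [e, ((ih 1).2 k).1 (by omega), ballot_zero_succ]
          ring
      · rw [e]
        cases k with
        | zero => rw [(ih 1).1 (by omega)]; simp
        | succ k => rw [((ih 1).2 k).2 (by omega)]; simp
    | succ t =>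
      have e : signedPaths 0 (j + 1) (2 * (t + 1)) =
          signedPaths 0 j (2 * t) - signedPaths 0 j (2 * (t + 2)) := by
        rw [show 2 * (t + 1) = 2 * t + 2 by ring, signedPaths]
        rfl
      rw [e]
      refine ⟨fun h => ?_, fun k => ⟨fun h => ?_, fun h => ?_⟩⟩
      · rw [(ih t).1 (by omega), (ih (t + 2)).1 (by omega)]; simp
      · rw [((ih t).2 k).1 (by omega)]
        cases k with
        | zero => rw [(ih (t + 2)).1 (by omega)]; simp [ballot]
        | succ k => rw [((ih (t + 2)).2 k).1 (by omega), ballot_succ_succ]; ring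
      · rw [((ih t).2 k).2 (by omega)]
        cases k with
        | zero => rw [(ih (t + 2)).1 (by omega)]; simp
        | succ k => rw [((ih (t + 2)).2 k).2 (by omega)]; simp

theorem signedPaths_zero_zero (n : ℕ) :
    signedPaths 0 n 0 = if Even n then (-1 : ℤ) ^ (n / 2) * (catalan (n / 2) : ℤ) else 0 := by
  rcases Nat.even_or_odd' n with ⟨k, rfl | rfl⟩
  · have h := (((signedPaths_zero_closed (2 * k)) 0).2 k).1 (by ring)
    rw [mul_zero, ballot_zero_eq_catalan] at h
    simp [h]
  · have h := (((signedPaths_zero_closed (2 * k + 1)) 0).2 k).2 (by ring)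
    rw [mul_zero] at h
    simp [h]

/-- On even heights, the operator g(t) ↦ g(t) + g(t - 1), with g(-1) = 0, intertwines the recursions
for x = 0 and x = 1. -/
theorem signedPaths_one_succ (n : ℕ) :
    signedPaths 1 (n + 1) 0 = signedPaths 0 n 0 ∧
    ∀ t : ℕ, signedPaths 1 (n + 1) (2 * t + 2) =
      signedPaths 0 n (2 * t + 2) + signedPaths 0 n (2 * t) := by
  induction n with
  | zero => exact ⟨by simp [signedPaths], fun t => by simp [signedPaths]⟩
  | succ n ih =>
    obtain ⟨h₀, h₁⟩ := ih
    constructor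
    · have h₂ := h₁ 0
      simp only [mul_zero, zero_add] at h₂
      rw [signedPaths, h₀, h₂, signedPaths]
      ring
    · intro t
      rw [signedPaths, signedPaths.eq_4 0, show 2 * t + 4 = 2 * (t + 1) + 2 by ring, h₁]
      cases t with
      | zero =>
        rw [mul_zero, h₀, signedPaths]
        ring_nf
      | succ t =>
        rw [show 2 * (t + 1) = 2 * t + 2 by ring, h₁, signedPaths]
        ring_nf

theorem signedPaths_one_zero (n : ℕ) (hn : 1 ≤ n) :
    signedPaths 1 n 0 =
      if Even n then 0 else (-1 : ℤ) ^ ((n - 1) / 2) * (catalan ((n - 1) / 2) : ℤ) := by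
  obtain ⟨m, rfl⟩ : ∃ m, n = m + 1 := ⟨n - 1, by omega⟩
  rw [(signedPaths_one_succ m).1, signedPaths_zero_zero, Nat.add_sub_cancel]
  by_cases h : Even m <;> simp [h, Nat.even_add_one]

/-! ### Symmetry between 213 and 132 -/

theorem contains_pattern132_iff {n : ℕ} (π : Equiv.Perm (Fin n)) :
    Contains π pattern132 ↔ ∃ a b c, a < b ∧ b < c ∧ π a < π c ∧ π c < π b := by
  constructor
  · rintro ⟨f, hf, h⟩
    exact ⟨f 0, f 1, f 2, hf _ _ (by decide), hf _ _ (by decide),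
      (h 0 2).2 (by decide), (h 2 1).2 (by decide)⟩
  · rintro ⟨a, b, c, hab, hbc, h₁, h₂⟩
    refine ⟨![a, b, c], ?_, ?_⟩
    · simp [Fin.forall_fin_succ, hab, hbc, hab.trans hbc]
    · simp [Fin.forall_fin_succ, pattern132_apply, h₁, h₂, h₁.trans h₂, h₁.le, h₂.le,
        (h₁.trans h₂).le]

theorem contains_pattern213_iff {n : ℕ} (π : Equiv.Perm (Fin n)) :
    Contains π pattern213 ↔ ∃ a b c, a < b ∧ b < c ∧ π b < π a ∧ π a < π c := by
  constructor
  · rintro ⟨f, hf, h⟩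
    exact ⟨f 0, f 1, f 2, hf _ _ (by decide), hf _ _ (by decide),
      (h 1 0).2 (by decide), (h 0 2).2 (by decide)⟩
  · rintro ⟨a, b, c, hab, hbc, h₁, h₂⟩
    refine ⟨![a, b, c], ?_, ?_⟩
    · simp [Fin.forall_fin_succ, hab, hbc, hab.trans hbc]
    · simp [Fin.forall_fin_succ, pattern213_apply, h₁, h₂, h₁.trans h₂, h₁.le, h₂.le,
        (h₁.trans h₂).le]

/-- Reverse-complement of the inverse. -/
def revInv {n : ℕ} : Equiv.Perm (Fin n) ≃ Equiv.Perm (Fin n) where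
  toFun π := Fin.revPerm * π⁻¹ * Fin.revPerm
  invFun π := Fin.revPerm * π⁻¹ * Fin.revPerm
  left_inv π := by ext i; simp
  right_inv π := by ext i; simp

theorem revInv_apply_rev {n : ℕ} (π : Equiv.Perm (Fin n)) (i : Fin n) :
    revInv π (π i).rev = i.rev := by
  simp [revInv]

theorem revInv_revInv {n : ℕ} (π : Equiv.Perm (Fin n)) : revInv (revInv π) = π :=
  revInv.left_inv π

theorem contains_pattern132_revInv {n : ℕ} {π : Equiv.Perm (Fin n)}
    (h : Contains π pattern213) : Contains (revInv π) pattern132 := by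
  rw [contains_pattern213_iff] at h
  rw [contains_pattern132_iff]
  obtain ⟨a, b, c, hab, hbc, h₁, h₂⟩ := h
  refine ⟨(π c).rev, (π a).rev, (π b).rev, ?_, ?_, ?_, ?_⟩ <;>
    simpa [revInv_apply_rev]

theorem contains_pattern213_revInv {n : ℕ} {π : Equiv.Perm (Fin n)}
    (h : Contains π pattern132) : Contains (revInv π) pattern213 := by
  rw [contains_pattern132_iff] at h
  rw [contains_pattern213_iff]
  obtain ⟨a, b, c, hab, hbc, h₁, h₂⟩ := h
  refine ⟨(π b).rev, (π c).rev, (π a).rev, ?_, ?_, ?_, ?_⟩ <;>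
    simpa [revInv_apply_rev]

theorem contains_pattern132_revInv_iff {n : ℕ} (π : Equiv.Perm (Fin n)) :
    Contains (revInv π) pattern132 ↔ Contains π pattern213 :=
  ⟨fun h => revInv_revInv π ▸ contains_pattern213_revInv h, contains_pattern132_revInv⟩

theorem mem_derangements_revInv_iff {n : ℕ} (π : Equiv.Perm (Fin n)) :
    revInv π ∈ derangements (Fin n) ↔ π ∈ derangements (Fin n) := by
  have key : ∀ π : Equiv.Perm (Fin n), π ∈ derangements (Fin n) →
      revInv π ∈ derangements (Fin n) := by
    intro π h i hi
    obtain ⟨j, rfl⟩ : ∃ j, i = (π j).rev := ⟨π⁻¹ i.rev, by simp⟩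
    rw [revInv_apply_rev, Fin.rev_inj] at hi
    exact h j hi.symm
  exact ⟨fun h => revInv_revInv π ▸ key _ h, key π⟩

theorem exc_revInv {n : ℕ} (π : Equiv.Perm (Fin n)) : exc (revInv π) = exc π := by
  unfold exc
  symm
  refine Finset.card_bij (fun i _ => (π i).rev) ?_ ?_ ?_
  · intro i hi
    simpa [revInv_apply_rev] using hi
  · intro i _ j _ h
    simpa using h
  · intro i hi
    obtain ⟨j, rfl⟩ : ∃ j, i = (π j).rev := ⟨π⁻¹ i.rev, by simp⟩
    refine ⟨j, ?_, rfl⟩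
    simpa [revInv_apply_rev] using hi

theorem sum_avoiding_pattern213 (n : ℕ) :
    ∑ π ∈ avoiding n pattern213, (-1 : ℤ) ^ exc π =
      ∑ π ∈ avoiding n pattern132, (-1 : ℤ) ^ exc π :=
  Finset.sum_equiv revInv
    (fun π => by simp [avoiding, contains_pattern132_revInv_iff])
    (fun π _ => by rw [exc_revInv])

theorem sum_derangementsAvoiding_pattern213 (n : ℕ) :
    ∑ π ∈ derangementsAvoiding n pattern213, (-1 : ℤ) ^ exc π =
      ∑ π ∈ derangementsAvoiding n pattern132, (-1 : ℤ) ^ exc π :=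
  Finset.sum_equiv revInv
    (fun π => by
      simp only [derangementsAvoiding, avoiding, Finset.mem_filter, Finset.mem_univ, true_and,
        contains_pattern132_revInv_iff, mem_derangements_revInv_iff])
    (fun π _ => by rw [exc_revInv])

/-! ### Decomposition of 132-avoiders by the position of the least value -/

/-- The permutations avoiding `132` that are increasing on the positions from `k` on. -/
def avoidingIncr (n k : ℕ) : Finset (Equiv.Perm (Fin n)) :=
  (avoiding n pattern132).filter fun π => ∀ a b : Fin n, k ≤ a → a < b → π a < π b

theorem mem_avoidingIncr {n k : ℕ} {π : Equiv.Perm (Fin n)} :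
    π ∈ avoidingIncr n k ↔ (∀ a b c, a < b → b < c → π a < π c → π b ≤ π c) ∧
      ∀ a b : Fin n, k ≤ a → a < b → π a < π b := by
  simp only [avoidingIncr, avoiding, Finset.mem_filter, Finset.mem_univ, true_and,
    contains_pattern132_iff]
  push Not
  rfl

/-- The permutation with value `0` at position `k` and pattern `σ` elsewhere. -/
def insertZero {n : ℕ} (k : Fin (n + 1)) (σ : Equiv.Perm (Fin n)) : Equiv.Perm (Fin (n + 1)) :=
  (finSuccEquiv' k).trans ((Equiv.optionCongr σ).trans (finSuccEquiv' 0).symm)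

theorem insertZero_self {n : ℕ} (k : Fin (n + 1)) (σ : Equiv.Perm (Fin n)) :
    insertZero k σ k = 0 := by
  simp [insertZero]

theorem insertZero_succAbove {n : ℕ} (k : Fin (n + 1)) (σ : Equiv.Perm (Fin n)) (i : Fin n) :
    insertZero k σ (k.succAbove i) = (σ i).succ := by
  simp [insertZero]

theorem insertZero_injective {n : ℕ} (k : Fin (n + 1)) :
    Function.Injective (insertZero k : Equiv.Perm (Fin n) → _) := by
  intro σ τ h
  ext i
  have := congrArg (fun π : Equiv.Perm (Fin (n + 1)) => π (k.succAbove i)) h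
  simp only [insertZero_succAbove, Fin.succ_inj] at this
  rw [this]

theorem exists_insertZero_eq {n : ℕ} {k : Fin (n + 1)} {π : Equiv.Perm (Fin (n + 1))}
    (h : π k = 0) : ∃ σ, insertZero k σ = π := by
  have hne : ∀ i, π (k.succAbove i) ≠ 0 := fun i hi =>
    Fin.succAbove_ne k i (π.injective (hi.trans h.symm))
  let f : Fin n → Fin n := fun i => (π (k.succAbove i)).pred (hne i)
  have hf : Function.Injective f := by
    intro i j hij
    simpa [f, Fin.pred_inj] using hij
  refine ⟨Equiv.ofBijective f (Finite.injective_iff_bijective.1 hf), ?_⟩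
  ext i
  rcases Fin.eq_self_or_eq_succAbove k i with rfl | ⟨j, rfl⟩
  · rw [insertZero_self, h]
  · rw [insertZero_succAbove]
    simp [f]

/-- In an occurrence of 132 the new value 0 could only play the 1, but the entries after it are
increasing. -/
theorem insertZero_mem_avoidingIncr {n : ℕ} {k : Fin (n + 1)} {σ : Equiv.Perm (Fin n)} :
    insertZero k σ ∈ avoidingIncr (n + 1) k ↔ σ ∈ avoidingIncr n k := by
  have hlt : ∀ i j : Fin n, k.succAbove i < k.succAbove j ↔ i < j := fun i j =>
    (Fin.strictMono_succAbove k).lt_iff_lt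
  have hval : ∀ i : Fin n, (k : ℕ) ≤ k.succAbove i ↔ (k : ℕ) ≤ i := fun i => by
    rcases lt_or_ge i.castSucc k with h | h
    · rw [Fin.succAbove_of_castSucc_lt _ _ h]; rfl
    · rw [Fin.succAbove_of_le_castSucc _ _ h, Fin.val_succ]
      have : (k : ℕ) ≤ i := h
      omega
  rw [mem_avoidingIncr, mem_avoidingIncr]
  constructor
  · rintro ⟨h₁, h₂⟩
    constructor
    · intro a b c hab hbc hac
      simpa [insertZero_succAbove] using h₁ (k.succAbove a) (k.succAbove b) (k.succAbove c)
        ((hlt _ _).2 hab) ((hlt _ _).2 hbc) (by simpa [insertZero_succAbove] using hac)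
    · intro a b ha hab
      simpa [insertZero_succAbove] using h₂ (k.succAbove a) (k.succAbove b)
        ((hval a).2 ha) ((hlt _ _).2 hab)
  · rintro ⟨h₁, h₂⟩
    have h₂' : ∀ a b : Fin (n + 1), (k : ℕ) ≤ a → a < b →
        insertZero k σ a < insertZero k σ b := by
      intro a b ha hab
      rcases Fin.eq_self_or_eq_succAbove k b with rfl | ⟨b, rfl⟩
      · exact absurd hab (not_lt.2 ha)
      rcases Fin.eq_self_or_eq_succAbove k a with rfl | ⟨a, rfl⟩
      · rw [insertZero_self, insertZero_succAbove]
        exact Fin.succ_pos _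
      · rw [insertZero_succAbove, insertZero_succAbove, Fin.succ_lt_succ_iff]
        exact h₂ a b ((hval a).1 ha) ((hlt _ _).1 hab)
    refine ⟨fun a b c hab hbc hac => ?_, h₂'⟩
    rcases Fin.eq_self_or_eq_succAbove k c with rfl | ⟨c, rfl⟩
    · rw [insertZero_self] at hac
      exact absurd hac (Fin.not_lt_zero _)
    rcases Fin.eq_self_or_eq_succAbove k b with rfl | ⟨b, rfl⟩
    · rw [insertZero_self]
      exact Fin.zero_le _
    rcases Fin.eq_self_or_eq_succAbove k a with rfl | ⟨a, rfl⟩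
    · exact (h₂' _ _ hab.le hbc).le
    · simp only [insertZero_succAbove, Fin.succ_lt_succ_iff, Fin.succ_le_succ_iff, hlt] at *
      exact h₁ a b c hab hbc hac

/-! ### From permutations to words -/

section Weights

variable {R : Type*} [CommRing R]

/-- The weight of a permutation, the value `v` at position `j` having weight `χ (c j + 2 * v)`. -/
def weight (χ : ℤ → R) {n : ℕ} (c : Fin n → ℤ) (π : Equiv.Perm (Fin n)) : R :=
  ∏ j, χ (c j + 2 * ((π j : ℕ) : ℤ))

theorem weight_insertZero (χ : ℤ → R) {n : ℕ} (c : Fin (n + 1) → ℤ) (k : Fin (n + 1))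
    (σ : Equiv.Perm (Fin n)) :
    weight χ c (insertZero k σ) = χ (c k) * weight χ (fun j => c (k.succAbove j) + 2) σ := by
  unfold weight
  rw [Fin.prod_univ_succAbove _ k, insertZero_self]
  simp only [insertZero_succAbove, Fin.val_succ]
  congr 1
  · simp
  · refine Finset.prod_congr rfl fun j _ => ?_
    congr 1
    push_cast
    ring

theorem sum_weight_apply_eq_zero (χ : ℤ → R) {n : ℕ} (c : Fin (n + 1) → ℤ) (k : Fin (n + 1)) :
    ∑ π ∈ (avoidingIncr (n + 1) k).filter (fun π => π k = 0), weight χ c π =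
      χ (c k) * ∑ σ ∈ avoidingIncr n k, weight χ (fun j => c (k.succAbove j) + 2) σ := by
  rw [Finset.mul_sum]
  symm
  refine Finset.sum_bij (fun σ _ => insertZero k σ) ?_ ?_ ?_ ?_
  · intro σ hσ
    exact Finset.mem_filter.2 ⟨insertZero_mem_avoidingIncr.2 hσ, insertZero_self k σ⟩
  · intro σ _ τ _ h
    exact insertZero_injective k h
  · intro π hπ
    obtain ⟨hπ, h0⟩ := Finset.mem_filter.1 hπ
    obtain ⟨σ, rfl⟩ := exists_insertZero_eq h0
    exact ⟨σ, insertZero_mem_avoidingIncr.1 hπ, rfl⟩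
  · intro σ _
    rw [weight_insertZero]

/-- If 0 is not at q, it lies at or before position k, because entries from q on increase. Either it
is at k, or it forms a 132 with k and q unless π k < π q; both ways the increasing run extends to k.
-/
theorem avoidingIncr_filter_ne_zero {n k : ℕ} (q : Fin (n + 1)) (hq : (q : ℕ) = k + 1) :
    (avoidingIncr (n + 1) (k + 1)).filter (fun π => ¬ π q = 0) = avoidingIncr (n + 1) k := by
  ext π
  rw [Finset.mem_filter, mem_avoidingIncr, mem_avoidingIncr]
  constructor
  · rintro ⟨⟨h₁, h₂⟩, h₀⟩
    refine ⟨h₁, fun a b ha hab => ?_⟩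
    rcases Nat.lt_or_ge k a with h | h
    · exact h₂ a b h hab
    have haq : a < q := Fin.lt_def.2 (by omega)
    have key : π a < π q := by
      by_contra hle
      have hne : π a ≠ π q := fun h => haq.ne (π.injective h)
      have hlt := lt_of_le_of_ne (not_lt.1 hle) hne.symm
      obtain ⟨z, hz⟩ := π.surjective 0
      have hzq : z ≠ q := fun h => h₀ (h ▸ hz)
      have hza : z ≠ a := fun h => by
        rw [← h, hz] at hlt
        exact Fin.not_lt_zero _ hlt
      rcases lt_or_gt_of_ne hzq with hlt' | hgt
      · have hza' : z < a := by
          refine lt_of_le_of_ne ?_ hza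
          rw [Fin.lt_def] at hlt'
          rw [Fin.le_def]
          omega
        have := h₁ z a q hza' haq (by rw [hz]; exact Fin.pos_iff_ne_zero.2 h₀)
        exact hle (lt_of_le_of_ne this hne)
      · have := h₂ q z hq.ge hgt
        rw [hz] at this
        exact Fin.not_lt_zero _ this
    have hqb : q ≤ b := by
      rw [Fin.lt_def] at hab
      rw [Fin.le_def]
      omega
    rcases hqb.eq_or_lt with rfl | h'
    · exact key
    · exact key.trans (h₂ q b hq.ge h')
  · rintro ⟨h₁, h₂⟩
    refine ⟨⟨h₁, fun a b ha => h₂ a b (by omega)⟩, fun h => ?_⟩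
    have := h₂ ⟨k, by omega⟩ q le_rfl (Fin.lt_def.2 (by simp [hq]))
    rw [h] at this
    exact Fin.not_lt_zero _ this

theorem avoidingIncr_eq_of_le {n k l : ℕ} (hk : n ≤ k + 1) (hl : n ≤ l + 1) :
    avoidingIncr n k = avoidingIncr n l := by
  have : ∀ m, n ≤ m + 1 → ∀ (π : Equiv.Perm (Fin n)) (a b : Fin n), m ≤ a → a < b → π a < π b := by
    intro m hm π a b ha hab
    have := b.isLt
    have : (a : ℕ) < b := hab
    omega
  ext π
  simp only [mem_avoidingIncr]
  exact and_congr_right fun _ => iff_of_true (this k hk π) (this l hl π)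

theorem apply_zero_of_mem_avoidingIncr_zero {n : ℕ} {π : Equiv.Perm (Fin (n + 1))}
    (h : π ∈ avoidingIncr (n + 1) 0) : π 0 = 0 := by
  obtain ⟨z, hz⟩ := π.surjective 0
  rcases eq_or_ne z 0 with rfl | hne
  · exact hz
  · have := (mem_avoidingIncr.1 h).2 0 z le_rfl (Fin.pos_iff_ne_zero.2 hne)
    rw [hz] at this
    exact absurd this (Fin.not_lt_zero _)

/-- The sum over the permutations avoiding `132` is a deque sum: values are assigned in increasing
order, and positions are pushed in decreasing order. -/
theorem sum_weight_eq_dequeSum (χ : ℤ → R) (m : ℕ) :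
    ∀ (n k : ℕ) (i : ℤ) (K : List ℤ) (c : Fin n → ℤ), n = k + K.length → m = k + n →
      (∀ j : Fin n, (j : ℕ) < k → c j = 2 * i + 2 * (k - 1 - (j : ℕ)) + 1) →
      (∀ (e : ℕ) (he : e < K.length) (h : k + e < n), c ⟨k + e, h⟩ = K[e] + i - e) →
      ∑ π ∈ avoidingIncr n k, weight χ c π = dequeSum χ m i K := by
  induction m with
  | zero =>
    intro n k i K c hn hm _ _
    obtain rfl : n = 0 := by omega
    obtain rfl : K = [] := List.eq_nil_of_length_eq_zero (by omega)
    have : avoidingIncr 0 k = Finset.univ := by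
      ext π
      simp only [mem_avoidingIncr, IsEmpty.forall_iff, and_self, Finset.mem_univ]
    rw [this]
    simp [weight, dequeSum]
  | succ m ih =>
    intro n k i K c hn hm hc₁ hc₂
    have push : ∀ k', k = k' + 1 → ∑ π ∈ avoidingIncr n k', weight χ c π =
        dequeSum χ m (i + 1) (i :: K) := by
      rintro k' rfl
      -- The number `c j` is the sum of push and pop time that j would have if it received the least
      -- remaining value, formally K[e] + i - e for an entry at depth e; a push leaves it unchanged.
      refine ih n k' (i + 1) (i :: K) c (by simp; omega) (by omega) ?_ ?_
      · intro j hj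
        rw [hc₁ j (by omega)]
        push_cast
        ring
      · intro e he h
        cases e with
        | zero =>
          rw [hc₁ _ (by simp)]
          simp
          ring
        | succ e =>
          have h' := hc₂ e (by simpa using he) (by omega)
          simp only [List.getElem_cons_succ]
          have : (⟨k' + (e + 1), h⟩ : Fin n) = ⟨k' + 1 + e, by omega⟩ := by
            ext; simp; ring
          rw [this, h']
          push_cast
          ring
    cases K with
    | nil =>
      obtain ⟨k', rfl⟩ : ∃ k', k = k' + 1 := ⟨k - 1, by simp at hn; omega⟩
      rw [dequeSum_succ_nil, ← push k' rfl]
      simp only [List.length_nil] at hn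
      -- With an empty store k' + 1 = n, and being increasing from the last position on is vacuous.
      rw [avoidingIncr_eq_of_le (k := k' + 1) (l := k')] <;> omega
    | cons t K =>
      simp only [List.length_cons] at hn
      obtain ⟨n, rfl⟩ : ∃ n', n = n' + 1 := ⟨n - 1, by omega⟩
      have hkn : k < n + 1 := by omega
      have hck : c ⟨k, hkn⟩ = t + i := by
        have := hc₂ 0 (by simp) (by omega)
        simpa using this
      have pop : ∑ σ ∈ avoidingIncr n k,
          weight χ (fun j => c ((⟨k, hkn⟩ : Fin (n + 1)).succAbove j) + 2) σ =
            dequeSum χ m (i + 1) K := by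
        refine ih n k (i + 1) K _ (by omega) (by omega) ?_ ?_
        · intro j hj
          rw [Fin.succAbove_of_castSucc_lt _ _ hj, hc₁ _ hj]
          simp only [Fin.val_castSucc]
          ring
        · intro e he h
          rw [Fin.succAbove_of_le_castSucc _ _ (Fin.le_def.2 (by simp))]
          have h' := hc₂ (e + 1) (by simpa using he) (by omega)
          simp only [Fin.succ_mk]
          simp only [List.getElem_cons_succ, ← add_assoc] at h'
          rw [h']
          push_cast
          ring
      have hz := sum_weight_apply_eq_zero χ c ⟨k, hkn⟩
      rw [pop, hck] at hz
      rw [dequeSum_succ_cons, ← hz, add_comm (dequeSum χ m (i + 1) (i :: t :: K))]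
      cases k with
      | zero =>
        -- No position is left to push; the word sum still offers a push, but the store would then
        -- outnumber the remaining letters.
        rw [dequeSum_eq_zero_of_lt χ m _ _ (by simp; omega), add_zero, Finset.filter_true_of_mem]
        intro π hπ
        exact apply_zero_of_mem_avoidingIncr_zero hπ
      | succ k =>
        rw [← push k rfl, ← avoidingIncr_filter_ne_zero ⟨k + 1, hkn⟩ rfl,
          Finset.sum_filter_add_sum_filter_not]

end Weights

/-! ### Specialisation to excedances and derangements -/

theorem sum_avoiding_pattern132 (x : ℤ) (n : ℕ) :
    ∑ π ∈ avoiding n pattern132, ∏ j : Fin n, signWeight x (2 * ((π j : ℕ) - (j : ℕ) : ℤ)) =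
      signedPaths x n 0 := by
  have h₁ := dequeSum_symmetric x n 0 [] (by simp)
  -- All n positions are unpushed at time 0; subtracting the doubled centre 2n - 1 from `c j + 2 v`
  -- leaves 2(v - j).
  have h₂ := sum_weight_eq_dequeSum
    (fun y => signWeight x (y - (2 * 0 + 2 * (n : ℤ) - 1))) (2 * n) n n 0 []
    (fun j => 2 * (n - 1 - (j : ℕ)) + 1) (by simp) (by ring) (fun j _ => by ring)
    (fun e he => by simp at he)
  rw [h₁] at h₂
  simp only [List.map_nil, List.prod_nil, one_mul, List.length_nil] at h₂
  rw [← h₂]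
  have h₃ : avoidingIncr n n = avoiding n pattern132 :=
    Finset.filter_true_of_mem fun π _ a _ ha => absurd a.isLt (not_lt.2 ha)
  rw [h₃]
  refine Finset.sum_congr rfl fun π _ => Finset.prod_congr rfl fun j _ => ?_
  congr 1
  ring

theorem prod_signWeight_one {n : ℕ} (π : Equiv.Perm (Fin n)) :
    ∏ j : Fin n, signWeight 1 (2 * ((π j : ℕ) - (j : ℕ) : ℤ)) = (-1) ^ exc π := by
  rw [exc, ← Finset.prod_const, Finset.prod_filter]
  refine Finset.prod_congr rfl fun j _ => ?_
  simp only [signWeight, Fin.lt_def]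
  split_ifs <;> first | rfl | omega

theorem prod_signWeight_zero {n : ℕ} (π : Equiv.Perm (Fin n)) [Decidable (π ∈ derangements (Fin n))] :
    ∏ j : Fin n, signWeight 0 (2 * ((π j : ℕ) - (j : ℕ) : ℤ)) =
      if π ∈ derangements (Fin n) then (-1) ^ exc π else 0 := by
  split_ifs with h
  · rw [← prod_signWeight_one]
    refine Finset.prod_congr rfl fun j _ => ?_
    have : (π j : ℕ) ≠ j := fun e => h j (Fin.ext e)
    simp only [signWeight]
    split_ifs <;> first | rfl | omega
  · obtain ⟨j, hj⟩ : ∃ j, π j = j := by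
      by_contra hne
      exact h fun j hj => hne ⟨j, hj⟩
    exact Finset.prod_eq_zero (Finset.mem_univ j) (by simp [signWeight, hj])

theorem sum_neg_one_pow_exc_avoiding (n : ℕ) :
    ∑ π ∈ avoiding n pattern132, (-1 : ℤ) ^ exc π = signedPaths 1 n 0 := by
  rw [← sum_avoiding_pattern132]
  exact Finset.sum_congr rfl fun π _ => (prod_signWeight_one π).symm

theorem sum_neg_one_pow_exc_derangementsAvoiding (n : ℕ) :
    ∑ π ∈ derangementsAvoiding n pattern132, (-1 : ℤ) ^ exc π = signedPaths 0 n 0 := by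
  rw [← sum_avoiding_pattern132, derangementsAvoiding, Finset.sum_filter]
  exact Finset.sum_congr rfl fun π _ => (prod_signWeight_zero π).symm

end PermPattern

theorem mainTheorem7 (n : ℕ) (hn : 1 ≤ n) :
    ((∑ π ∈ PermPattern.avoiding n PermPattern.pattern213, (-1 : ℤ) ^ PermPattern.exc π) =
        (if Even n then 0 else (-1 : ℤ) ^ ((n - 1) / 2) * (catalan ((n - 1) / 2) : ℤ)) ∧
      (∑ π ∈ PermPattern.avoiding n PermPattern.pattern132, (-1 : ℤ) ^ PermPattern.exc π) =
        (if Even n then 0 else (-1 : ℤ) ^ ((n - 1) / 2) * (catalan ((n - 1) / 2) : ℤ))) ∧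
    ((∑ π ∈ PermPattern.derangementsAvoiding n PermPattern.pattern213,
          (-1 : ℤ) ^ PermPattern.exc π) =
        (if Even n then (-1 : ℤ) ^ (n / 2) * (catalan (n / 2) : ℤ) else 0) ∧
      (∑ π ∈ PermPattern.derangementsAvoiding n PermPattern.pattern132,
          (-1 : ℤ) ^ PermPattern.exc π) =
        (if Even n then (-1 : ℤ) ^ (n / 2) * (catalan (n / 2) : ℤ) else 0)) := by
  open PermPattern in
  exact ⟨⟨by rw [sum_avoiding_pattern213, sum_neg_one_pow_exc_avoiding, signedPaths_one_zero n hn],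
    by rw [sum_neg_one_pow_exc_avoiding, signedPaths_one_zero n hn]⟩,
    by rw [sum_derangementsAvoiding_pattern213, sum_neg_one_pow_exc_derangementsAvoiding,
      signedPaths_zero_zero],
    by rw [sum_neg_one_pow_exc_derangementsAvoiding, signedPaths_zero_zero]⟩
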